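/- In bin packing, an input $I$ is a finite sequence of items with rational sizes in $(0,1]$; a packing partitions the items into bins so that the total size of the items in each bin is at most $1$, and $OPT(I)$ denotes the minimum number of bins in a packing of $I$. In bin packing with known optimal cost (K-O), an online algorithm is told the number $OPT(I)$ before the first item arrives; the items of $I$ then arrive one by one, and each has to be assigned irrevocably to a bin before anything about the later items is revealed. For a deterministic online algorithm $A$ for K-O, let $A(I)$ be the number of bins that $A$ uses for $I$. The (asymptotic) competitive ratio of $A$ is $$R_A=\limsup_{Q\to\infty}\ \frac{1}{Q}\,\sup\{A(I) : OPT(I)=Q\}\in[0,\infty].$$ **Theorem.** Every deterministic online algorithm $A$ for K-O satisfies $R_A\ge \frac{87}{62}\approx 1.4032258$. -/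

import Mathlib

namespace BinPacking

/-- An item, given by its size, a rational number in `(0, 1]`. -/
abbrev Item : Type := Set.Ioc (0 : ℚ) 1

/-- An input: a finite sequence of items, in order of arrival. -/
abbrev Input : Type := List Item

/-- `f` assigns to each item of `I` the label of its bin. It is a packing if the total size of
the items in every bin is at most `1`. -/
def IsPacking (I : Input) (f : Fin I.length → ℕ) : Prop :=
  ∀ b : ℕ, ∑ i with f i = b, (I.get i : ℚ) ≤ 1

/-- The number of (non-empty) bins used by an assignment of `n` items to bins. -/
def binsUsed {n : ℕ} (f : Fin n → ℕ) : ℕ :=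
  (Finset.univ.image f).card

/-- The optimal offline cost: the minimum number of bins in a packing of `I`. -/
noncomputable def opt (I : Input) : ℕ :=
  sInf {m : ℕ | ∃ f : Fin I.length → ℕ, IsPacking I f ∧ binsUsed f = m}

/-- A deterministic online algorithm for bin packing with known optimal cost. -/
structure KnownOptAlgorithm where
  /-- `place Q past x` is the label of the bin that receives the new item `x`, given the announced
  optimal cost `Q` and the sequence `past` of the items that arrived before `x`. (The earlier
  decisions of the algorithm are determined by `Q` and `past`.) -/
  place : ℕ → List Item → Item → ℕ
  /-- On every input whose optimal cost is announced correctly, the algorithm produces a packing. -/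
  feasible : ∀ I : Input,
    IsPacking I (fun i => place (opt I) (I.take i) (I.get i))

namespace KnownOptAlgorithm

/-- The number of bins used by the algorithm `A` on the input `I`, where the optimal cost of `I`
is announced in advance. -/
noncomputable def cost (A : KnownOptAlgorithm) (I : Input) : ℕ :=
  binsUsed (fun i : Fin I.length => A.place (opt I) (I.take i) (I.get i))

open scoped ENNReal in
/-- The largest cost (possibly `∞`) of `A` over all inputs with optimal cost `Q`. -/
noncomputable def worstCost (A : KnownOptAlgorithm) (Q : ℕ) : ℝ≥0∞ :=
  ⨆ I ∈ {I : Input | opt I = Q}, (A.cost I : ℝ≥0∞)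

open scoped ENNReal in
/-- The asymptotic competitive ratio of `A`, an element of `[0, ∞]`. -/
noncomputable def competitiveRatio (A : KnownOptAlgorithm) : ℝ≥0∞ :=
  Filter.limsup (fun Q : ℕ => A.worstCost Q / (Q : ℝ≥0∞)) Filter.atTop

end KnownOptAlgorithm

end BinPacking

/-! This is an adversary argument. Let `Q = 40K` and suppose that at most `c` bins are ever used.
Items of size 1 can raise the optimum of any input that fits into `Q` bins to exactly `Q`, so the
bound `c` holds on all such inputs (`costBound_place`), and the adversary may branch after any
prefix. Every branch ends with `t` equal items larger than 1/2; then `t` plus the number of bins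
closed to them is at most `c` (`CostBound.card_add_le`).

The input starts with `40K` tiny items slightly above 1/8, chosen adaptively so that exactly those
opening a bin are large, with an excess at least four times that of any small one
(`exists_isAdaptiveStage`). Every bin of the algorithm then contains a large item, whereas an
offline packing can match the small items with final items that fit into none of these bins.

There are three ways to go on: with items of size 7/8 − α at once, which penalizes many bins
(`card_add_le_of_first_stage`); with a second adaptive stage of medium items slightly above 9/25
(`exists_few_or_many`); with `38K` items of size 3/8 − 3α/2 (`sum_weightTight_add_le`). Each gives
linear inequalities in the numbers of bins holding `a` tiny items, `1 ≤ a ≤ 7`. In `le_of_costBound`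
a linear combination of them bounds `c` from below. -/

namespace BinPacking

/-! ### Packings as multisets distributed over bins, and the optimal cost. -/

/-- The multiset of sizes of an input. -/
def sizes (I : Input) : Multiset ℚ := (I.map (fun x : Item => (x : ℚ)) : List ℚ)

/-- The multiset `s` can be distributed over `n` bins of capacity `q`. -/
def PackableIn (s : Multiset ℚ) (n : ℕ) (q : ℚ) : Prop :=
  ∃ g : Fin n → Multiset ℚ, ∑ i, g i = s ∧ ∀ i, (g i).sum ≤ q

namespace PackableIn

theorem mono {s : Multiset ℚ} {n : ℕ} {q r : ℚ} (h : PackableIn s n q) (hqr : q ≤ r) :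
    PackableIn s n r := by
  obtain ⟨g, hg, hq⟩ := h
  exact ⟨g, hg, fun i => (hq i).trans hqr⟩

/-- The capacity is a parameter so that layers of items can be packed separately and stacked; with
`juxtapose`, this produces all the explicit packings below. -/
theorem superpose {s t : Multiset ℚ} {n : ℕ} {q r : ℚ} (h : PackableIn s n q)
    (h' : PackableIn t n r) : PackableIn (s + t) n (q + r) := by
  obtain ⟨g, hg, hq⟩ := h
  obtain ⟨g', hg', hq'⟩ := h'
  refine ⟨fun i => g i + g' i, by rw [Finset.sum_add_distrib, hg, hg'], fun i => ?_⟩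
  rw [Multiset.sum_add]
  exact add_le_add (hq i) (hq' i)

theorem juxtapose {s t : Multiset ℚ} {n m : ℕ} {q : ℚ} (h : PackableIn s n q)
    (h' : PackableIn t m q) : PackableIn (s + t) (n + m) q := by
  obtain ⟨g, hg, hq⟩ := h
  obtain ⟨g', hg', hq'⟩ := h'
  refine ⟨Fin.append g g', ?_, fun i => ?_⟩
  · rw [Fin.sum_univ_add]
    simp [hg, hg']
  · refine Fin.addCases (fun i => ?_) (fun i => ?_) i
    · simpa using hq i
    · simpa using hq' i

theorem zero (n : ℕ) : PackableIn 0 n 0 := ⟨fun _ => 0, by simp, fun _ => by simp⟩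

theorem mono_bins {s : Multiset ℚ} {n m : ℕ} {q : ℚ} (hq : 0 ≤ q) (h : PackableIn s n q)
    (hnm : n ≤ m) : PackableIn s m q := by
  have := h.juxtapose ((zero (m - n)).mono hq)
  rwa [add_zero, Nat.add_sub_cancel' hnm] at this

theorem single {s : Multiset ℚ} {q : ℚ} (h : s.sum ≤ q) : PackableIn s 1 q :=
  ⟨fun _ => s, by simp, fun _ => h⟩

theorem sum_le {s : Multiset ℚ} {n : ℕ} {q : ℚ} (h : PackableIn s n q) : s.sum ≤ n * q := by
  obtain ⟨g, rfl, hq⟩ := h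
  have : (∑ i, g i).sum = ∑ i, (g i).sum := map_sum Multiset.sumAddMonoidHom g Finset.univ
  rw [this]
  calc ∑ i, (g i).sum ≤ ∑ _i : Fin n, q := Finset.sum_le_sum fun i _ => hq i
    _ = n * q := by simp

end PackableIn

theorem exists_add_of_le_card {α : Type*} (s : Multiset α) {k : ℕ} (h : k ≤ s.card) :
    ∃ t u, s = t + u ∧ t.card = k := by
  induction s using Quotient.inductionOn with
  | _ l =>
    refine ⟨(l.take k : List α), (l.drop k : List α), ?_, ?_⟩
    · simp
    · simpa using h

/-- Items of size at most `u` can be distributed evenly. -/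
theorem PackableIn.of_card {s : Multiset ℚ} {u : ℚ} (hu : 0 ≤ u) (c n : ℕ)
    (hs : ∀ x ∈ s, x ≤ u) (hc : s.card ≤ c * n) : PackableIn s n (c * u) := by
  induction n generalizing s with
  | zero =>
    have : s = 0 := by simpa using hc
    subst this
    exact (PackableIn.zero 0).mono (by positivity)
  | succ n ih =>
    obtain ⟨t, r, rfl, ht⟩ := exists_add_of_le_card s (min_le_right c s.card)
    rw [Multiset.card_add] at hc ht
    have hr : r.card ≤ c * n := by
      rw [mul_add] at hc
      rcases min_choice c (t.card + r.card) with h | h <;> rw [h] at ht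
      · omega
      · have : r.card = 0 := by omega
        rw [this]; exact Nat.zero_le _
    have htc : t.card ≤ c := ht ▸ min_le_left _ _
    have h1 : PackableIn t 1 (c * u) := by
      refine PackableIn.single ?_
      calc t.sum ≤ t.card • u := Multiset.sum_le_card_nsmul t u
            fun x hx => hs x (Multiset.mem_add.2 (Or.inl hx))
        _ = t.card * u := by rw [nsmul_eq_mul]
        _ ≤ c * u := by
          have : (t.card : ℚ) ≤ c := by exact_mod_cast htc
          exact mul_le_mul_of_nonneg_right this hu
    have := (ih (fun x hx => hs x (Multiset.mem_add.2 (Or.inr hx))) hr).juxtapose h1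
    rwa [add_comm r t] at this

/-- Single items, at most one per bin. -/
theorem PackableIn.of_card_one {s : Multiset ℚ} {u : ℚ} (hu : 0 ≤ u) {n : ℕ}
    (hs : ∀ x ∈ s, x ≤ u) (hc : s.card ≤ n) : PackableIn s n u := by
  simpa using PackableIn.of_card hu 1 n hs (by simpa using hc)

/-- Items of equal size are interchangeable: the first item goes to any bin whose multiset contains
its size, one copy is deleted there, and induction handles the rest. -/
theorem exists_assignment (n : ℕ) (I : Input) (g : Fin n → Multiset ℚ) (hg : ∑ i, g i = sizes I) :
    ∃ f : Fin I.length → Fin n, ∀ b, ∑ i with f i = b, (I.get i : ℚ) = (g b).sum := by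
  induction I generalizing g with
  | nil =>
    have h0 : ∀ b, g b = 0 := fun b => by
      have := (Finset.sum_eq_zero_iff.1 (hg.trans (by simp [sizes]))) b (Finset.mem_univ _)
      exact this
    exact ⟨fun i => i.elim0, fun b => by simp [h0 b]⟩
  | cons x I ih =>
    have hx : (x : ℚ) ∈ ∑ i, g i := by rw [hg]; simp [sizes]
    obtain ⟨j, -, hj⟩ := Multiset.mem_sum.1 hx
    obtain ⟨t, ht⟩ := Multiset.exists_cons_of_mem hj
    have hsum : ∑ i, Function.update g j t i = sizes I := by
      have h1 : ∑ i, g i = (x : ℚ) ::ₘ ∑ i, Function.update g j t i := by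
        rw [Finset.sum_update_of_mem (Finset.mem_univ j),
          ← Finset.add_sum_erase _ _ (Finset.mem_univ j), ht, Multiset.cons_add,
          Finset.sdiff_singleton_eq_erase]
      rw [hg] at h1
      have h2 : sizes (x :: I) = (x : ℚ) ::ₘ sizes I := by simp [sizes]
      rw [h2] at h1
      exact ((Multiset.cons_inj_right _).1 h1).symm
    obtain ⟨f, hf⟩ := ih _ hsum
    refine ⟨Fin.cons j f, fun b => ?_⟩
    rw [Finset.sum_filter]
    have := hf b
    rw [Finset.sum_filter] at this
    have hsplit : (∑ i : Fin (I.length + 1),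
        if (Fin.cons j f : Fin (I.length + 1) → Fin n) i = b then ((x :: I).get i : ℚ) else 0) =
        (if j = b then (x : ℚ) else 0) + ∑ i, if f i = b then (I.get i : ℚ) else 0 := by
      rw [Fin.sum_univ_succ]
      rfl
    refine hsplit.trans ?_
    rw [this]
    by_cases hb : j = b
    · subst hb
      simp [ht]
    · simp [hb, Function.update_of_ne (Ne.symm hb)]

theorem packable_of_isPacking {I : Input} {f : Fin I.length → ℕ} (hf : IsPacking I f) :
    PackableIn (sizes I) (binsUsed f) 1 := by
  classical
  let U := Finset.univ.image f
  let e : Fin (binsUsed f) ≃ U := (Fintype.equivFinOfCardEq (by simp [U, binsUsed])).symm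
  refine ⟨fun j => (Finset.univ.filter fun i => f i = e j).val.map fun i => (I.get i : ℚ), ?_, ?_⟩
  · rw [Equiv.sum_comp e (fun b : U => (Finset.univ.filter fun i => f i = b).val.map
      fun i => (I.get i : ℚ))]
    rw [Finset.sum_coe_sort U (fun b : ℕ => (Finset.univ.filter fun i => f i = b).val.map
      fun i => (I.get i : ℚ))]
    have h1 : ∀ s : Finset (Fin I.length), s.val.map (fun i => (I.get i : ℚ)) =
        ∑ i ∈ s, {(I.get i : ℚ)} := fun s => by
      have := Multiset.sum_map_singleton (s.val.map fun i => (I.get i : ℚ))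
      rw [Multiset.map_map] at this
      exact this.symm
    simp_rw [h1]
    rw [Finset.sum_fiberwise_of_maps_to (fun i _ => Finset.mem_image_of_mem f (Finset.mem_univ i)),
      ← h1]
    have h2 : I.map (fun x : Item => (x : ℚ)) = List.ofFn fun i => (I.get i : ℚ) := by
      conv_lhs => rw [← List.ofFn_get I, List.map_ofFn]
      rfl
    rw [sizes, h2, List.ofFn_eq_map]
    rfl
  · intro j
    exact hf (e j)

theorem opt_le_iff (I : Input) (n : ℕ) : opt I ≤ n ↔ PackableIn (sizes I) n 1 := by
  constructor
  · intro h
    have hne : {m : ℕ | ∃ f : Fin I.length → ℕ, IsPacking I f ∧ binsUsed f = m}.Nonempty := by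
      refine ⟨_, fun i => i, fun b => ?_, rfl⟩
      rw [Finset.sum_filter]
      by_cases hb : b < I.length
      · rw [Finset.sum_eq_single ⟨b, hb⟩]
        · simpa using (I.get ⟨b, hb⟩).2.2
        · intro i _ hi
          rw [if_neg]
          rintro rfl
          exact hi rfl
        · simp
      · rw [Finset.sum_eq_zero]
        · exact zero_le_one
        · intro i _
          rw [if_neg]
          rintro rfl
          exact hb i.2
    obtain ⟨f, hf, hfm⟩ := Nat.sInf_mem hne
    exact ((packable_of_isPacking hf).mono_bins zero_le_one (hfm.trans_le h))
  · rintro ⟨g, hg, hq⟩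
    obtain ⟨f, hf⟩ := exists_assignment n I g hg
    suffices h : IsPacking I (fun i => (f i : ℕ)) ∧ binsUsed (fun i => (f i : ℕ)) ≤ n by
      have hm : binsUsed (fun i => (f i : ℕ)) ∈
          {m : ℕ | ∃ f : Fin I.length → ℕ, IsPacking I f ∧ binsUsed f = m} := ⟨_, h.1, rfl⟩
      exact (Nat.sInf_le hm).trans h.2
    refine ⟨fun b => ?_, ?_⟩
    · by_cases hb : b < n
      · have := hf ⟨b, hb⟩
        have h2 : (Finset.univ.filter fun i => (f i : ℕ) = b) =
            Finset.univ.filter fun i => f i = ⟨b, hb⟩ := by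
          ext i; simp [Fin.ext_iff]
        rw [h2, this]
        exact hq _
      · rw [Finset.filter_false_of_mem]
        · simp
        · rintro i - rfl
          exact hb (f i).2
    · calc binsUsed (fun i => (f i : ℕ)) ≤ (Finset.range n).card := by
            refine Finset.card_le_card fun b hb => ?_
            obtain ⟨i, -, rfl⟩ := Finset.mem_image.1 hb
            exact Finset.mem_range.2 (f i).2
        _ = n := Finset.card_range n

theorem sizes_append (I J : Input) : sizes (I ++ J) = sizes I + sizes J := by
  simp [sizes, ← Multiset.coe_add]

/-- An input that fits into `Q` bins can be extended to one of optimal cost exactly `Q`. -/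
theorem exists_extension_opt_eq {I : Input} {Q : ℕ} (h : PackableIn (sizes I) Q 1) :
    ∃ J, opt (I ++ J) = Q := by
  let one : Item := ⟨1, by norm_num, le_rfl⟩
  have hex : ∃ k, Q ≤ opt (I ++ List.replicate k one) := by
    refine ⟨Q, ?_⟩
    have h1 := ((opt_le_iff (I ++ List.replicate Q one) _).1 le_rfl).sum_le
    rw [sizes_append, Multiset.sum_add] at h1
    have h2 : 0 ≤ (sizes I).sum := Multiset.sum_nonneg fun x hx => by
      simp only [sizes, Multiset.mem_coe, List.mem_map] at hx
      obtain ⟨y, -, rfl⟩ := hx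
      exact y.2.1.le
    have h3 : (sizes (List.replicate Q one)).sum = Q := by simp [sizes, one]
    have : (Q : ℚ) ≤ opt (I ++ List.replicate Q one) := by linarith
    exact_mod_cast this
  classical
  have hk := Nat.find_spec hex
  rcases hn : Nat.find hex with _ | k
  · rw [hn] at hk
    exact ⟨_, le_antisymm ((opt_le_iff _ _).2 (by simpa [sizes_append, sizes] using h)) hk⟩
  · refine ⟨_, le_antisymm ?_ hk⟩
    -- One item fewer leaves the optimum below `Q`, and an item of size 1 raises it by at most one,
    -- so it cannot jump past `Q`.
    have hlt := Nat.find_min hex (m := k) (by omega)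
    push Not at hlt
    rw [hn, List.replicate_succ', ← List.append_assoc]
    have h1 := (opt_le_iff (I ++ List.replicate k one) _).1 le_rfl
    have h2 : PackableIn (sizes [one]) 1 1 := PackableIn.single (by simp [sizes, one])
    have h3 := h1.juxtapose h2
    rw [← sizes_append] at h3
    have := (opt_le_iff _ _).2 h3
    omega

/-! ### Runs of an online rule: bins, loads and item counts. -/

/-- The items of `I` with their bins, when the rule `P` is applied after the items `past`. -/
def run (P : List Item → Item → ℕ) : Input → Input → List (Item × ℕ)
  | _, [] => []
  | past, x :: I => (x, P past x) :: run P (past ++ [x]) I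

/-- The bins that are non-empty. -/
def used (l : List (Item × ℕ)) : Finset ℕ := (l.map Prod.snd).toFinset

/-- The total size of the items in a bin. -/
def load (l : List (Item × ℕ)) (b : ℕ) : ℚ :=
  ((l.filter fun p => p.2 = b).map fun p => (p.1 : ℚ)).sum

/-- The number of items in a bin. -/
def cnt (l : List (Item × ℕ)) (b : ℕ) : ℕ := (l.filter fun p => p.2 = b).length

theorem run_append (P : List Item → Item → ℕ) (past I J : Input) :
    run P past (I ++ J) = run P past I ++ run P (past ++ I) J := by
  induction I generalizing past with
  | nil => simp [run]
  | cons x I ih => simp [run, ih]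

theorem run_eq_ofFn (P : List Item → Item → ℕ) (past I : Input) :
    run P past I =
      List.ofFn fun i : Fin I.length => (I.get i, P (past ++ I.take i) (I.get i)) := by
  induction I generalizing past with
  | nil => simp [run]
  | cons x I ih =>
    rw [run, ih]
    refine Eq.trans ?_ (List.ofFn_succ (f := fun i : Fin (I.length + 1) =>
      ((x :: I).get i, P (past ++ (x :: I).take i) ((x :: I).get i)))).symm
    simp

theorem map_fst_run (P : List Item → Item → ℕ) (past I : Input) :
    (run P past I).map Prod.fst = I := by
  induction I generalizing past with
  | nil => rfl
  | cons x I ih => simp [run, ih]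

theorem length_run (P : List Item → Item → ℕ) (past I : Input) :
    (run P past I).length = I.length := by
  rw [← List.length_map (f := Prod.fst), map_fst_run]

theorem fst_mem_of_mem_run {P : List Item → Item → ℕ} {past I : Input} {p : Item × ℕ}
    (h : p ∈ run P past I) : p.1 ∈ I := by
  rw [← map_fst_run P past I]
  exact List.mem_map_of_mem h

theorem mem_used {l : List (Item × ℕ)} {b : ℕ} : b ∈ used l ↔ ∃ x, (x, b) ∈ l := by
  simp [used]

theorem used_append (l l' : List (Item × ℕ)) : used (l ++ l') = used l ∪ used l' := by
  simp [used]

theorem load_append (l l' : List (Item × ℕ)) (b : ℕ) :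
    load (l ++ l') b = load l b + load l' b := by
  simp [load]

theorem load_nonneg (l : List (Item × ℕ)) (b : ℕ) : 0 ≤ load l b :=
  List.sum_nonneg fun x hx => by
    obtain ⟨p, -, rfl⟩ := List.mem_map.1 hx
    exact p.1.2.1.le

theorem cnt_eq_zero_iff {l : List (Item × ℕ)} {b : ℕ} : cnt l b = 0 ↔ b ∉ used l := by
  rw [cnt, List.length_eq_zero_iff, List.filter_eq_nil_iff, mem_used]
  constructor
  · rintro h ⟨x, hx⟩
    exact h _ hx (by simp)
  · rintro h ⟨x, b'⟩ hx hb
    obtain rfl : b' = b := by simpa using hb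
    exact h ⟨x, hx⟩

theorem cnt_pos {l : List (Item × ℕ)} {b : ℕ} (hb : b ∈ used l) : 1 ≤ cnt l b := by
  by_contra h
  exact cnt_eq_zero_iff.1 (by omega) hb

theorem sum_cnt {l : List (Item × ℕ)} {s : Finset ℕ} (hs : used l ⊆ s) :
    ∑ b ∈ s, cnt l b = l.length := by
  have h := Multiset.sum_count_eq_card (s := s) (m := ((l.map Prod.snd : List ℕ) : Multiset ℕ))
    fun a ha => hs (by simpa [used] using ha)
  have h2 : ∀ b, cnt l b = Multiset.count b ((l.map Prod.snd : List ℕ) : Multiset ℕ) := by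
    intro b
    rw [Multiset.coe_count, List.count_eq_countP, List.countP_map, List.countP_eq_length_filter,
      cnt]
    congr 2
  simp_rw [h2, h]
  simp

theorem length_mul_le_sum {l : List ℚ} {u : ℚ} (h : ∀ x ∈ l, u ≤ x) : l.length * u ≤ l.sum := by
  induction l with
  | nil => simp
  | cons x l ih =>
    have h1 := ih fun y hy => h y (List.mem_cons_of_mem _ hy)
    have h2 := h x List.mem_cons_self
    simp only [List.length_cons, List.sum_cons]
    push_cast
    linarith

theorem cnt_mul_le_load {l : List (Item × ℕ)} {u : ℚ} (h : ∀ p ∈ l, u ≤ (p.1 : ℚ)) (b : ℕ) :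
    cnt l b * u ≤ load l b := by
  have := length_mul_le_sum (l := (l.filter fun p => p.2 = b).map fun p => (p.1 : ℚ)) (u := u)
    fun x hx => by
      obtain ⟨p, hp, rfl⟩ := List.mem_map.1 hx
      exact h p (List.mem_of_mem_filter hp)
  rwa [List.length_map] at this

theorem cnt_mul_add_le_load {l : List (Item × ℕ)} {u : ℚ} (h : ∀ p ∈ l, u ≤ (p.1 : ℚ)) {b : ℕ}
    {x : Item} (hx : (x, b) ∈ l) : (cnt l b - 1) * u + x ≤ load l b := by
  have hx' : (x : ℚ) ∈ (l.filter fun p => p.2 = b).map fun p => (p.1 : ℚ) :=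
    List.mem_map.2 ⟨(x, b), by simpa using hx, rfl⟩
  have hperm := List.perm_cons_erase hx'
  have h1 := hperm.sum_eq
  have h2 := hperm.length_eq
  have h3 := length_mul_le_sum
    (l := ((l.filter fun p => p.2 = b).map fun p => (p.1 : ℚ)).erase (x : ℚ)) (u := u)
    fun y hy => by
      obtain ⟨p, hp, rfl⟩ := List.mem_map.1 (List.mem_of_mem_erase hy)
      exact h p (List.mem_of_mem_filter hp)
  rw [List.length_map, List.length_cons] at h2
  rw [List.sum_cons] at h1
  rw [load, h1, cnt, h2]
  push_cast
  linarith

/-! ### Cost bounds for prefixes. -/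

/-- On inputs that fit into `Q` bins, the rule `P` packs feasibly and uses at most `c` bins. -/
def CostBound (P : List Item → Item → ℕ) (Q c : ℕ) : Prop :=
  ∀ I, PackableIn (sizes I) Q 1 → (∀ b, load (run P [] I) b ≤ 1) ∧ (used (run P [] I)).card ≤ c

/-- The input is extended to one for which the announcement `Q` is correct. Loads and the set of
used bins only grow along the extension, so both guarantees pass back to the prefix. -/
theorem costBound_place (A : KnownOptAlgorithm) {Q c : ℕ} (h : ∀ I, opt I = Q → A.cost I ≤ c) :
    CostBound (A.place Q) Q c := by
  intro I hI
  obtain ⟨J, hJ⟩ := exists_extension_opt_eq hI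
  have hrun := run_append (A.place Q) [] I J
  constructor
  · intro b
    have h1 := A.feasible (I ++ J) b
    rw [hJ] at h1
    have h2 : load (run (A.place Q) [] (I ++ J)) b =
        ∑ i ∈ Finset.univ.filter fun i : Fin (I ++ J).length =>
          A.place Q ((I ++ J).take i) ((I ++ J).get i) = b, ((I ++ J).get i : ℚ) := by
      rw [run_eq_ofFn, load, List.ofFn_eq_map, List.filter_map, List.map_map]
      rfl
    rw [← h2, hrun, load_append] at h1
    linarith [load_nonneg (run (A.place Q) ([] ++ I) J) b]
  · have h1 := h _ hJ
    have h2 : A.cost (I ++ J) = (used (run (A.place Q) [] (I ++ J))).card := by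
      rw [KnownOptAlgorithm.cost, binsUsed, run_eq_ofFn, used, hJ]
      congr 1
      ext b
      simp only [Finset.mem_image, Finset.mem_univ, true_and, List.mem_toFinset, List.mem_map,
        List.mem_ofFn, List.nil_append]
      constructor
      · rintro ⟨i, hi⟩
        exact ⟨_, ⟨i, rfl⟩, hi⟩
      · rintro ⟨_, ⟨i, rfl⟩, hi⟩
        exact ⟨i, hi⟩
    rw [h2, hrun, used_append] at h1
    exact (Finset.card_le_card Finset.subset_union_left).trans h1

/-- If a prefix is followed by `t` items of a size `w > 1/2`, then they need `t` bins, and the only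
bins of the prefix that can be reused are those with enough space. -/
theorem CostBound.card_add_le {P : List Item → Item → ℕ} {Q c : ℕ} (h : CostBound P Q c)
    {I : Input} {w : Item} {t : ℕ} (hw : 1 / 2 < (w : ℚ))
    (hp : PackableIn (sizes I + Multiset.replicate t (w : ℚ)) Q 1) :
    (used (run P [] I)).card + t ≤
      c + ((used (run P [] I)).filter fun b => load (run P [] I) b + w ≤ 1).card := by
  have hs : sizes (I ++ List.replicate t w) = sizes I + Multiset.replicate t (w : ℚ) := by
    rw [sizes_append, sizes, sizes, List.map_replicate, Multiset.coe_replicate]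
  obtain ⟨h1, h2⟩ := h (I ++ List.replicate t w) (hs ▸ hp)
  rw [run_append, List.nil_append] at h1 h2
  set l := run P [] I
  set l' := run P I (List.replicate t w) with hl'
  have hl'w : ∀ p ∈ l', p.1 = w := fun p hp =>
    List.eq_of_mem_replicate (fst_mem_of_mem_run hp)
  have hload : ∀ b, load l b + cnt l' b * w ≤ 1 := fun b => by
    have h3 := cnt_mul_le_load (l := l') (u := (w : ℚ)) (fun p hp => (hl'w p hp ▸ le_rfl)) b
    have h4 := h1 b
    rw [load_append] at h4
    linarith
  have hcnt : ∀ b, cnt l' b ≤ 1 := fun b => by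
    by_contra hb
    have h3 : (2 : ℚ) ≤ cnt l' b := by exact_mod_cast (by omega : 2 ≤ cnt l' b)
    nlinarith [hload b, load_nonneg l b]
  have hcard : t ≤ (used l').card := by
    have h3 := sum_cnt (l := l') subset_rfl
    rw [hl', length_run, List.length_replicate, ← hl'] at h3
    calc t = ∑ b ∈ used l', cnt l' b := h3.symm
      _ ≤ ∑ _b ∈ used l', 1 := Finset.sum_le_sum fun b _ => hcnt b
      _ = _ := by simp
  have hinter : used l ∩ used l' ⊆ (used l).filter fun b => load l b + w ≤ 1 := by
    intro b hb
    rw [Finset.mem_inter] at hb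
    refine Finset.mem_filter.2 ⟨hb.1, ?_⟩
    have h3 : (1 : ℚ) ≤ cnt l' b := by exact_mod_cast cnt_pos hb.2
    nlinarith [hload b]
  rw [used_append] at h2
  have h3 := Finset.card_union_add_card_inter (used l) (used l')
  have h4 := Finset.card_le_card hinter
  omega

/-! ### Adaptive choice of item sizes. -/

/-- Items can be chosen adaptively so that a single threshold separates those on which a property
of the current decision holds from the others. -/
theorem exists_adaptive (dec : List Item → Item → Prop) (item : ℕ → Item) (n : ℕ) (past : Input)
    (lo : ℕ) : ∃ (I : Input) (T : ℕ), I.length = n ∧ lo ≤ T ∧ T < lo + 2 ^ n ∧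
      ∀ J x K, I = J ++ x :: K →
        ∃ e, x = item e ∧ (dec (past ++ J) x → e < T) ∧ (¬ dec (past ++ J) x → T ≤ e) := by
  induction n generalizing past lo with
  | zero => exact ⟨[], lo, by simp⟩
  | succ n ih =>
    have h2 : 1 ≤ 2 ^ n := Nat.one_le_two_pow
    -- Binary search: `e` is the last index of the lower half of `[lo, lo + 2 ^ (n + 1))`, and the
    -- decision on `item e` determines the half in which `T` is sought.
    set e := lo + 2 ^ n - 1 with he
    have key : ∀ T', (dec past (item e) → e < T') → (¬ dec past (item e) → T' ≤ e) →
        ∀ I : Input, (∀ J x K, I = J ++ x :: K → ∃ e', x = item e' ∧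
          (dec (past ++ [item e] ++ J) x → e' < T') ∧
          (¬ dec (past ++ [item e] ++ J) x → T' ≤ e')) →
        ∀ J x K, item e :: I = J ++ x :: K → ∃ e, x = item e ∧
          (dec (past ++ J) x → e < T') ∧ (¬ dec (past ++ J) x → T' ≤ e) := by
      intro T' h1 h2 I hI J x K hJ
      rcases J with _ | ⟨y, J⟩
      · rw [List.nil_append, List.cons.injEq] at hJ
        obtain ⟨rfl, rfl⟩ := hJ
        exact ⟨e, rfl, by simpa using h1, by simpa using h2⟩
      · rw [List.cons_append, List.cons.injEq] at hJ
        obtain ⟨rfl, hJ⟩ := hJ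
        obtain ⟨e', h3, h4, h5⟩ := hI J x K hJ
        exact ⟨e', h3, by simpa using h4, by simpa using h5⟩
    by_cases hd : dec past (item e)
    · obtain ⟨I, T, hn, hlo, hT, hI⟩ := ih (past ++ [item e]) (lo + 2 ^ n)
      refine ⟨item e :: I, T, by simp [hn], by omega, by rw [pow_succ]; omega, ?_⟩
      exact key T (fun _ => by omega) (fun h => absurd hd h) I hI
    · obtain ⟨I, T, hn, hlo, hT, hI⟩ := ih (past ++ [item e]) lo
      refine ⟨item e :: I, T, by simp [hn], by omega, by rw [pow_succ]; omega, ?_⟩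
      exact key T (fun h => absurd h hd) (fun _ => by omega) I hI

/-- If exactly the items that open a new bin are larger than `θ`, then the number of these items is
the number of new bins, and each new bin contains such an item. -/
theorem card_used_of_threshold {P : List Item → Item → ℕ} {past : Input} {θ : ℚ} (I : Input)
    (h : ∀ (J : Input) (x : Item) (K : Input), I = J ++ x :: K →
      (θ < (x : ℚ) ↔ P (past ++ J) x ∉ used (run P [] (past ++ J)))) :
    (used (run P [] (past ++ I))).card =
        (used (run P [] past)).card + I.countP (fun x : Item => θ < (x : ℚ)) ∧
      ∀ b ∈ used (run P [] (past ++ I)), b ∉ used (run P [] past) →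
        ∃ x : Item, (x, b) ∈ run P past I ∧ θ < (x : ℚ) := by
  induction I using List.reverseRecOn with
  | nil =>
    refine ⟨by simp, fun b hb hb' => ?_⟩
    rw [List.append_nil] at hb
    exact absurd hb hb'
  | append_singleton I x ih =>
    obtain ⟨ih1, ih2⟩ := ih fun J y K hJ => h J y (K ++ [x]) (by simp [hJ])
    have hx := h I x [] rfl
    have hrun : run P [] (past ++ (I ++ [x])) =
        run P [] (past ++ I) ++ [(x, P (past ++ I) x)] := by
      rw [← List.append_assoc, run_append]
      simp [run]
    have hrun' : run P past (I ++ [x]) = run P past I ++ [(x, P (past ++ I) x)] := by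
      rw [run_append]
      simp [run]
    have hused : used (run P [] (past ++ (I ++ [x]))) =
        insert (P (past ++ I) x) (used (run P [] (past ++ I))) := by
      rw [hrun, used_append, Finset.union_comm]
      rfl
    rw [hrun', hused, List.countP_append, List.countP_singleton]
    by_cases hθ : θ < (x : ℚ)
    · have hnew := hx.1 hθ
      constructor
      · rw [Finset.card_insert_of_notMem hnew, ih1]
        simp [hθ, add_assoc]
      · intro b hb hb'
        rcases Finset.mem_insert.1 hb with rfl | hb
        · exact ⟨x, by simp, hθ⟩
        · obtain ⟨y, hy, hy'⟩ := ih2 b hb hb'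
          exact ⟨y, List.mem_append_left _ hy, hy'⟩
    · have hold : P (past ++ I) x ∈ used (run P [] (past ++ I)) := by
        by_contra hc
        exact hθ (hx.2 hc)
      rw [Finset.insert_eq_of_mem hold]
      constructor
      · simp [hθ, ih1]
      · intro b hb hb'
        obtain ⟨y, hy, hy'⟩ := ih2 b hb hb'
        exact ⟨y, List.mem_append_left _ hy, hy'⟩

/-- An item slightly larger than `u`. -/
def itemAbove (u : ℚ) (hu : 0 < u ∧ u ≤ 1 / 2) (e : ℕ) : Item :=
  ⟨u + 1 / (1000 * 4 ^ e), by
    have h4 : (1 : ℚ) ≤ 4 ^ e := one_le_pow₀ (by norm_num)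
    have h1 : (1 : ℚ) / (1000 * 4 ^ e) ≤ 1 / 1000 :=
      one_div_le_one_div_of_le (by norm_num) (by linarith)
    have h2 : (0 : ℚ) < 1 / (1000 * 4 ^ e) := by positivity
    constructor <;> [linarith [hu.1]; linarith [hu.2]]⟩

/-- After the items `past`, the items `I` have sizes slightly above `u`, and exactly those opening
new bins are large, which means that they exceed `u` by at least `4 * α` instead of at most `α`. -/
structure IsAdaptiveStage (P : List Item → Item → ℕ) (past I : Input) (n : ℕ) (u α : ℚ) :
    Prop where
  length_eq : I.length = n
  pos : 0 < α
  le : α ≤ 1 / 1000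
  lt_item : ∀ x ∈ I, u < (x : ℚ)
  item_le : ∀ x ∈ I, (x : ℚ) ≤ u + 1 / 1000
  card_used : (used (run P [] (past ++ I))).card =
    (used (run P [] past)).card + ((sizes I).filter fun x => u + α < x).card
  exists_large : ∀ b ∈ used (run P [] (past ++ I)), b ∉ used (run P [] past) →
    ∃ x : Item, (x, b) ∈ run P past I ∧ u + 4 * α ≤ (x : ℚ)

/-- The excess over `u` shrinks by a factor 4 with each index. With `α` the excess at the threshold
index `T`, smaller indices give at least `4 * α` and all others at most `α`. -/
theorem exists_isAdaptiveStage (P : List Item → Item → ℕ) (past : Input) (n : ℕ) {u : ℚ}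
    (hu : 0 < u ∧ u ≤ 1 / 2) : ∃ I α, IsAdaptiveStage P past I n u α := by
  obtain ⟨I, T, hn, -, -, hI⟩ := exists_adaptive
    (fun J x => P J x ∉ used (run P [] J)) (itemAbove u hu) n past 0
  have hmono : ∀ {a b : ℕ}, a ≤ b → (1 : ℚ) / (1000 * 4 ^ b) ≤ 1 / (1000 * 4 ^ a) := fun h =>
    one_div_le_one_div_of_le (by positivity)
      (mul_le_mul_of_nonneg_left (pow_le_pow_right₀ (by norm_num) h) (by norm_num))
  have hpos : ∀ a : ℕ, (0 : ℚ) < 1 / (1000 * 4 ^ a) := fun a => by positivity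
  have hlarge : ∀ {e}, e < T → u + 4 * (1 / (1000 * 4 ^ T)) ≤ (itemAbove u hu e : ℚ) := by
    intro e he
    have h1 := hmono (show e + 1 ≤ T from he)
    have h2 : (4 : ℚ) * (1 / (1000 * 4 ^ (e + 1))) = 1 / (1000 * 4 ^ e) := by
      rw [pow_succ]; field_simp
    simp only [itemAbove]
    linarith
  have hiff : ∀ (J : Input) (x : Item) (K : Input), I = J ++ x :: K →
      ((u + 1 / (1000 * 4 ^ T) < (x : ℚ) ↔ P (past ++ J) x ∉ used (run P [] (past ++ J))) ∧
        ∃ e, x = itemAbove u hu e ∧ (u + 1 / (1000 * 4 ^ T) < (x : ℚ) → e < T)) := by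
    intro J x K hJ
    obtain ⟨e, rfl, h1, h2⟩ := hI J x K hJ
    have h3 : u + 1 / (1000 * 4 ^ T) < (itemAbove u hu e : ℚ) → e < T := by
      intro h
      by_contra hc
      have := hmono (not_lt.1 hc)
      simp only [itemAbove] at h
      linarith
    refine ⟨⟨fun h => ?_, fun h => ?_⟩, e, rfl, h3⟩
    · by_contra hc
      exact absurd (h3 h) (not_lt.2 (h2 (not_not.2 hc)))
    · linarith [hlarge (h1 h), hpos T]
  have hmem : ∀ x ∈ I, ∃ e, x = itemAbove u hu e ∧ (u + 1 / (1000 * 4 ^ T) < (x : ℚ) → e < T) := by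
    intro x hx
    obtain ⟨J, K, hJ⟩ := List.append_of_mem hx
    exact (hiff J x K hJ).2
  obtain ⟨h1, h2⟩ := card_used_of_threshold I fun J x K hJ => (hiff J x K hJ).1
  refine ⟨I, 1 / (1000 * 4 ^ T), hn, hpos T, ?_, ?_, ?_, ?_, ?_⟩
  · simpa using hmono (Nat.zero_le T)
  · intro x hx
    obtain ⟨e, rfl, -⟩ := hmem x hx
    simp only [itemAbove]
    linarith [hpos e]
  · intro x hx
    obtain ⟨e, rfl, -⟩ := hmem x hx
    have := hmono (Nat.zero_le e)
    simp only [itemAbove]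
    simpa using this
  · rw [h1, sizes, Multiset.filter_coe, Multiset.coe_card, ← List.countP_eq_length_filter,
      List.countP_map]
    rfl
  · intro b hb hb'
    obtain ⟨x, hx, hθ⟩ := h2 b hb hb'
    obtain ⟨e, rfl, he⟩ := hmem x (fst_mem_of_mem_run hx)
    exact ⟨_, hx, hlarge (he hθ)⟩

theorem card_sizes (I : Input) : (sizes I).card = I.length := by simp [sizes]

theorem mem_sizes {I : Input} {x : ℚ} : x ∈ sizes I ↔ ∃ y ∈ I, (y : ℚ) = x := by
  rw [sizes, Multiset.mem_coe, List.mem_map]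

namespace IsAdaptiveStage

variable {P : List Item → Item → ℕ} {past I : Input} {n : ℕ} {u α : ℚ}

theorem le_of_mem_sizes (h : IsAdaptiveStage P past I n u α) :
    ∀ x ∈ sizes I, x ≤ u + 1 / 1000 := by
  intro x hx
  obtain ⟨y, hy, rfl⟩ := mem_sizes.1 hx
  exact h.item_le y hy

/-- The items of an adaptive stage split into large and small ones. -/
theorem exists_split (h : IsAdaptiveStage P past I n u α) :
    ∃ L S : Multiset ℚ, sizes I = L + S ∧ L.card + S.card = n ∧
      (used (run P [] (past ++ I))).card = (used (run P [] past)).card + L.card ∧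
      (∀ x ∈ L, x ≤ u + 1 / 1000) ∧ ∀ x ∈ S, x ≤ u + α := by
  refine ⟨(sizes I).filter fun x => u + α < x, (sizes I).filter fun x => ¬ u + α < x,
    (Multiset.filter_add_not _ _).symm, ?_, h.card_used, fun x hx => ?_, fun x hx => ?_⟩
  · rw [← Multiset.card_add, Multiset.filter_add_not, card_sizes, h.length_eq]
  · exact h.le_of_mem_sizes x (Multiset.mem_of_mem_filter hx)
  · exact not_lt.1 (Multiset.mem_filter.1 hx).2

theorem le_fst (h : IsAdaptiveStage P past I n u α) : ∀ p ∈ run P past I, u ≤ (p.1 : ℚ) :=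
  fun _ hp => (h.lt_item _ (fst_mem_of_mem_run hp)).le

end IsAdaptiveStage

/-! ### Counting bins and items across consecutive stages. -/

theorem used_subset (P : List Item → Item → ℕ) (I J : Input) :
    used (run P [] I) ⊆ used (run P [] (I ++ J)) := by
  rw [run_append, used_append]
  exact Finset.subset_union_left

theorem one_le_cnt_of_mem_of_notMem {P : List Item → Item → ℕ} {I J : Input} {b : ℕ}
    (hb : b ∈ used (run P [] (I ++ J))) (hb' : b ∉ used (run P [] I)) : 1 ≤ cnt (run P I J) b := by
  rw [run_append, used_append, Finset.mem_union] at hb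
  exact cnt_pos (hb.resolve_left hb')

/-- The weighted form of `CostBound.card_add_le`: bins without space for `w` count. -/
theorem CostBound.sum_add_le {P : List Item → Item → ℕ} {Q c : ℕ} (h : CostBound P Q c)
    {I : Input} {w : Item} {t : ℕ} (hw : 1 / 2 < (w : ℚ))
    (hp : PackableIn (sizes I + Multiset.replicate t (w : ℚ)) Q 1) :
    ∑ b ∈ used (run P [] I), (if load (run P [] I) b + w ≤ 1 then 0 else 1) + t ≤ c := by
  have h1 := h.card_add_le hw hp
  have h2 : ∑ b ∈ used (run P [] I), (if load (run P [] I) b + w ≤ 1 then 0 else 1) =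
      ((used (run P [] I)).filter fun b => ¬ load (run P [] I) b + w ≤ 1).card := by
    rw [Finset.card_filter]
    exact Finset.sum_congr rfl fun b _ => by split_ifs <;> rfl
  have h3 := Finset.card_filter_add_card_filter_not (s := used (run P [] I))
    (fun b => load (run P [] I) b + w ≤ 1)
  omega

/-- If all bins are too full for `w`, they all count. -/
theorem CostBound.card_add_le_of_closed {P : List Item → Item → ℕ} {Q c : ℕ}
    (h : CostBound P Q c) {I : Input} {w : Item} {t : ℕ} (hw : 1 / 2 < (w : ℚ))
    (hp : PackableIn (sizes I + Multiset.replicate t (w : ℚ)) Q 1)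
    (hc : ∀ b ∈ used (run P [] I), 1 < load (run P [] I) b + w) :
    (used (run P [] I)).card + t ≤ c := by
  have h1 := h.card_add_le hw hp
  rw [Finset.filter_false_of_mem fun b hb => not_le.2 (hc b hb)] at h1
  simpa using h1

theorem sum_used_append {P : List Item → Item → ℕ} (I J : Input) {g : ℕ → ℕ} (hg : g 0 = 0) :
    ∑ b ∈ used (run P [] (I ++ J)), g (cnt (run P [] I) b) =
      ∑ b ∈ used (run P [] I), g (cnt (run P [] I) b) := by
  refine (Finset.sum_subset (used_subset P I J) fun b _ hb => ?_).symm
  rw [cnt_eq_zero_iff.2 hb, hg]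

theorem sum_cnt_append {P : List Item → Item → ℕ} (I J : Input) :
    ∑ b ∈ used (run P [] (I ++ J)), cnt (run P I J) b = J.length := by
  rw [sum_cnt, length_run]
  rw [run_append, used_append]
  exact Finset.subset_union_right

theorem sum_new (P : List Item → Item → ℕ) (I J : Input) :
    ∑ b ∈ used (run P [] (I ++ J)), (if cnt (run P [] I) b = 0 then 1 else 0) +
      (used (run P [] I)).card = (used (run P [] (I ++ J))).card := by
  have h1 : ∑ b ∈ used (run P [] (I ++ J)), (if cnt (run P [] I) b = 0 then 1 else 0) =
      (used (run P [] (I ++ J)) \ used (run P [] I)).card := by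
    rw [← Finset.card_filter]
    congr 1
    ext b
    rw [Finset.mem_filter, Finset.mem_sdiff, cnt_eq_zero_iff]
  rw [h1]
  exact Finset.card_sdiff_add_card_eq_card (used_subset P I J)

theorem packableIn_replicate {w : ℚ} (hw : 0 ≤ w) {t n : ℕ} (h : t ≤ n) :
    PackableIn (Multiset.replicate t w) n w :=
  PackableIn.of_card_one hw (fun x hx => (Multiset.eq_of_mem_replicate hx).le) (by simpa using h)

/-- A multiset of items of size at most `u` together with one item `w` per bin. -/
theorem packableIn_add_replicate {s : Multiset ℚ} {u w : ℚ} {n c : ℕ} (hu : 0 ≤ u) (hw : 0 ≤ w)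
    (hs : ∀ x ∈ s, x ≤ u) (hc : s.card ≤ c * n) :
    PackableIn (s + Multiset.replicate n w) n (c * u + w) :=
  (PackableIn.of_card hu c n hs hc).superpose (packableIn_replicate hw le_rfl)

/-! ### The tiny items, slightly above 1/8. -/

section FirstStage

variable {P : List Item → Item → ℕ} {K c : ℕ} {I : Input} {α : ℚ}

theorem IsAdaptiveStage.exists_split_nil {n : ℕ} {u : ℚ} (h : IsAdaptiveStage P [] I n u α) :
    ∃ L S : Multiset ℚ, sizes I = L + S ∧ L.card + S.card = n ∧
      L.card = (used (run P [] I)).card ∧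
      (∀ x ∈ L, x ≤ u + 1 / 1000) ∧ ∀ x ∈ S, x ≤ u + α := by
  obtain ⟨L, S, h1, h2, h3, h4, h5⟩ := h.exists_split
  refine ⟨L, S, h1, h2, ?_, h4, h5⟩
  have h6 : (used (run P [] ([] : Input))).card = 0 := rfl
  rw [h6, zero_add] at h3
  exact h3.symm

theorem IsAdaptiveStage.load_ge {n : ℕ} {u : ℚ} (h : IsAdaptiveStage P [] I n u α) {b : ℕ}
    (hb : b ∈ used (run P [] I)) : cnt (run P [] I) b * u + 4 * α ≤ load (run P [] I) b := by
  obtain ⟨x, hx, hxu⟩ := h.exists_large b hb (by simp [used, run])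
  have := cnt_mul_add_le_load h.le_fst hx
  linarith

/-- Offline, the large items are packed seven to a bin, and every other bin receives an item of size
7/8 − α, with room for one small item. Online, each used bin contains a large item and is closed to
the size 7/8 − α. -/
theorem card_add_le_of_first_stage (hP : CostBound P (40 * K) c)
    (h : IsAdaptiveStage P [] I (40 * K) (1 / 8) α) :
    (used (run P [] I)).card + 40 * K ≤ c + ((used (run P [] I)).card + 6) / 7 := by
  obtain ⟨L, S, hI, hn, hX, hL, hS⟩ := h.exists_split_nil
  have hα := h.pos
  have hα' := h.le
  set X := (used (run P [] I)).card
  set m := (X + 6) / 7 with hm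
  let w : Item := ⟨7 / 8 - α, by linarith, by linarith⟩
  have hw : (w : ℚ) = 7 / 8 - α := rfl
  have h1 : PackableIn L m 1 :=
    (PackableIn.of_card (u := 63 / 500) (by norm_num) 7 m
      (fun x hx => (hL x hx).trans (by norm_num)) (by omega)).mono (by norm_num)
  have h2 : PackableIn (S + Multiset.replicate (40 * K - m) (w : ℚ)) (40 * K - m) 1 :=
    (packableIn_add_replicate (c := 1) (by linarith) (by linarith) hS (by omega)).mono
      (by rw [hw]; push_cast; linarith)
  have h3 := h1.juxtapose h2
  rw [← add_assoc, ← hI, Nat.add_sub_cancel' (by omega)] at h3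
  have h4 := hP.card_add_le_of_closed (w := w) (by linarith) h3 fun b hb => by
    have h5 := h.load_ge hb
    have h6 : (1 : ℚ) ≤ cnt (run P [] I) b := by exact_mod_cast cnt_pos hb
    linarith
  omega

theorem cnt_le_seven (hP : CostBound P (40 * K) c) (hpack : PackableIn (sizes I) (40 * K) 1)
    (h : IsAdaptiveStage P [] I (40 * K) (1 / 8) α) {b : ℕ} (hb : b ∈ used (run P [] I)) :
    cnt (run P [] I) b ≤ 7 := by
  have h1 := h.load_ge hb
  have h2 := (hP I hpack).1 b
  have h3 := h.pos
  by_contra hc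
  have h4 : (8 : ℚ) ≤ cnt (run P [] I) b := by exact_mod_cast (by omega)
  linarith

end FirstStage

/-! ### The medium items, slightly above 9/25, and their three continuations. -/

section MediumItems

variable {P : List Item → Item → ℕ} {K c : ℕ} {I J : Input} {α β : ℚ}

theorem packableIn_medium (h : IsAdaptiveStage P [] I (40 * K) (1 / 8) α)
    (h' : IsAdaptiveStage P I J (40 * K) (9 / 25) β) :
    PackableIn (sizes (I ++ J)) (20 * K) 1 := by
  rw [sizes_append]
  refine ((PackableIn.of_card (u := 63 / 500) (by norm_num) 2 _ (fun x hx => ?_) ?_).superpose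
    (PackableIn.of_card (u := 361 / 1000) (by norm_num) 2 _ (fun x hx => ?_) ?_)).mono ?_
  · exact (h.le_of_mem_sizes x hx).trans (by norm_num)
  · rw [card_sizes, h.length_eq]; omega
  · exact (h'.le_of_mem_sizes x hx).trans (by norm_num)
  · rw [card_sizes, h'.length_eq]; omega
  · norm_num

theorem card_add_le_medium_full (hP : CostBound P (40 * K) c)
    (h : IsAdaptiveStage P [] I (40 * K) (1 / 8) α)
    (h' : IsAdaptiveStage P I J (40 * K) (9 / 25) β) :
    (used (run P [] (I ++ J))).card + 20 * K ≤ c := by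
  let w : Item := ⟨1, by norm_num⟩
  have hw : (w : ℚ) = 1 := rfl
  have h1 := (packableIn_medium h h').juxtapose
    (packableIn_replicate (w := (w : ℚ)) (by norm_num) (le_refl (20 * K)))
  rw [← add_mul] at h1
  refine hP.card_add_le_of_closed (w := w) (by norm_num) h1 fun b hb => ?_
  have h2 := cnt_mul_le_load (l := run P [] (I ++ J)) (u := 1 / 8) (fun p hp => ?_) b
  · have h3 : (1 : ℚ) ≤ cnt (run P [] (I ++ J)) b := by exact_mod_cast cnt_pos hb
    linarith
  · rw [run_append, List.mem_append] at hp
    rcases hp with hp | hp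
    · exact h.le_fst p hp
    · linarith [h'.le_fst p hp]

theorem sum_add_le_medium_half (hP : CostBound P (40 * K) c)
    (h : IsAdaptiveStage P [] I (40 * K) (1 / 8) α)
    (h' : IsAdaptiveStage P I J (40 * K) (9 / 25) β) :
    ∑ b ∈ used (run P [] (I ++ J)),
      (if load (run P [] (I ++ J)) b + 101 / 200 ≤ 1 then 0 else 1) + 40 * K ≤ c := by
  let w : Item := ⟨101 / 200, by norm_num⟩
  refine hP.sum_add_le (w := w) (by norm_num [w]) ?_
  rw [sizes_append]
  refine (((PackableIn.of_card_one (u := 63 / 500) (by norm_num) (fun x hx => ?_) ?_).superpose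
    (PackableIn.of_card_one (u := 361 / 1000) (by norm_num) (fun x hx => ?_) ?_)).superpose
    (packableIn_replicate (by norm_num [w]) le_rfl)).mono ?_
  · exact (h.le_of_mem_sizes x hx).trans (by norm_num)
  · rw [card_sizes, h.length_eq]
  · exact (h'.le_of_mem_sizes x hx).trans (by norm_num)
  · rw [card_sizes, h'.length_eq]
  · norm_num [w]

/-- Offline, `e` bins take two tiny and two medium items each, including all `Z` large medium ones.
Then `40K − 2e` bins pair a small medium item with a final item, and `e` bins hold a final item and
at most two of the remaining tiny items, which suffices because `e ≥ 10K`. -/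
theorem sum_add_le_medium_complement (hP : CostBound P (40 * K) c)
    (h : IsAdaptiveStage P [] I (40 * K) (1 / 8) α)
    (h' : IsAdaptiveStage P I J (40 * K) (9 / 25) β) {e Z : ℕ}
    (hZ : (used (run P [] (I ++ J))).card = (used (run P [] I)).card + Z)
    (hZe : Z ≤ 2 * e) (he : 10 * K ≤ e) (he' : e ≤ 20 * K) :
    ∑ b ∈ used (run P [] (I ++ J)),
      (if load (run P [] (I ++ J)) b + (16 / 25 - β) ≤ 1 then 0 else 1) + (40 * K - e) ≤ c := by
  obtain ⟨L, S, hJ, hn, hX, hL, hS⟩ := h'.exists_split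
  have hβ := h'.pos
  have hβ' := h'.le
  let w : Item := ⟨16 / 25 - β, by linarith, by linarith⟩
  have hw : (w : ℚ) = 16 / 25 - β := rfl
  refine hP.sum_add_le (w := w) (by linarith) ?_
  obtain ⟨S₁, S₂, rfl, hS₁⟩ := exists_add_of_le_card S (k := 2 * e - Z) (by omega)
  rw [Multiset.card_add] at hn
  have hIc : (sizes I).card = 40 * K := by rw [card_sizes, h.length_eq]
  obtain ⟨I₁, I₂, hI, hI₁⟩ := exists_add_of_le_card (sizes I) (k := 2 * e) (by omega)
  have hIu : ∀ x ∈ I₁ + I₂, x ≤ 63 / 500 := fun x hx =>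
    (h.le_of_mem_sizes x (hI ▸ hx)).trans (by norm_num)
  rw [hI, Multiset.card_add] at hIc
  have h1 : PackableIn (I₁ + (L + S₁)) e 1 := by
    refine ((PackableIn.of_card (u := 63 / 500) (by norm_num) 2 e (fun x hx => ?_) ?_).superpose
      (PackableIn.of_card (u := 361 / 1000) (by norm_num) 2 e (fun x hx => ?_) ?_)).mono ?_
    · exact hIu x (Multiset.mem_add.2 (Or.inl hx))
    · omega
    · rcases Multiset.mem_add.1 hx with hx | hx
      · exact (hL x hx).trans (by norm_num)
      · exact (hS x (Multiset.mem_add.2 (Or.inl hx))).trans (by linarith)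
    · rw [Multiset.card_add]; omega
    · norm_num
  have h2 : PackableIn (S₂ + Multiset.replicate (40 * K - 2 * e) (w : ℚ)) (40 * K - 2 * e) 1 :=
    (packableIn_add_replicate (c := 1) (u := 9 / 25 + β) (by linarith) (by linarith)
      (fun x hx => hS x (Multiset.mem_add.2 (Or.inr hx))) (by omega)).mono
      (by rw [hw]; push_cast; linarith)
  have h3 : PackableIn (I₂ + Multiset.replicate e (w : ℚ)) e 1 :=
    (packableIn_add_replicate (c := 2) (u := 63 / 500) (by norm_num) (by linarith)
      (fun x hx => hIu x (Multiset.mem_add.2 (Or.inr hx))) (by omega)).mono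
      (by rw [hw]; push_cast; linarith)
  have h4 := (h1.juxtapose h2).juxtapose h3
  have h5 : sizes (I ++ J) + Multiset.replicate (40 * K - e) (w : ℚ) =
      I₁ + (L + S₁) + (S₂ + Multiset.replicate (40 * K - 2 * e) (w : ℚ)) +
        (I₂ + Multiset.replicate e (w : ℚ)) := by
    rw [sizes_append, hI, hJ, show 40 * K - e = (40 * K - 2 * e) + e by omega,
      Multiset.replicate_add]
    abel
  rw [h5]
  convert h4 using 1
  omega

end MediumItems

/-! ### Weights of bins, and the inequalities from the medium items. -/

/-- The weight of a bin with `a` tiny items, if few medium items open new bins. -/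
def weightFew (a : ℕ) : ℕ := if a ≤ 2 then 0 else if a ≤ 5 then 1 else 2

/-- The weight of a bin with `a` tiny items, if many medium items open new bins. -/
def weightMany (a : ℕ) : ℕ := if a = 0 then 0 else if a ≤ 2 then 1 else if a ≤ 5 then 2 else 3

/-- A second weight of a bin with `a` tiny items, if many medium items open new bins. -/
def weightMany' (a : ℕ) : ℕ := if a ≤ 2 then 0 else if a ≤ 5 then 2 else 3

/-- The weight of a bin with `a` tiny items for medium items that fit exactly. -/
def weightTight (a : ℕ) : ℕ := if a ≤ 1 then 0 else if a ≤ 4 then 1 else 2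

/-- Sizes are counted in thousandths. The values `p = 1` and `q = 1` mark bins closed to the final
items 101/200 and 16/25 − β. The weight of `a` is the least value of `p + q - n` over all feasible
numbers `n` of medium items; the other weights arise likewise from other combinations. -/
theorem weightFew_add_le {a n p q : ℕ} (h : 125 * a + 360 * n < 1000)
    (hp : 125 * a + 360 * n ≤ 495 ∨ p = 1) (hq : 125 * a + 360 * n ≤ 361 ∧ a ≠ 0 ∨ q = 1) :
    weightFew a + n ≤ p + q := by
  rw [weightFew]
  split_ifs <;> omega

theorem weightMany_add_le {a n p q : ℕ} (h : 125 * a + 360 * n < 1000)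
    (hp : 125 * a + 360 * n ≤ 495 ∨ p = 1) (hq : 125 * a + 360 * n ≤ 361 ∧ a ≠ 0 ∨ q = 1) :
    weightMany a + n + (if a = 0 then 1 else 0) ≤ 1 + p + q := by
  rw [weightMany]
  split_ifs <;> omega

theorem weightMany'_add_le {a n p q : ℕ} (h : 125 * a + 360 * n < 1000)
    (hp : 125 * a + 360 * n ≤ 495 ∨ p = 1) (hq : 125 * a + 360 * n ≤ 361 ∧ a ≠ 0 ∨ q = 1) :
    weightMany' a + n + (if a = 0 then 1 else 0) ≤ p + 2 * q := by
  rw [weightMany']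
  split_ifs <;> omega

section MediumItems

variable {P : List Item → Item → ℕ} {K c : ℕ} {I J : Input} {α β : ℚ}

/-- The contents of a bin after the medium items, and its available space. -/
theorem medium_bin (hP : CostBound P (40 * K) c)
    (h : IsAdaptiveStage P [] I (40 * K) (1 / 8) α)
    (h' : IsAdaptiveStage P I J (40 * K) (9 / 25) β) {b : ℕ}
    (hb : b ∈ used (run P [] (I ++ J))) {a n : ℕ} (ha : cnt (run P [] I) b = a)
    (hn : cnt (run P I J) b = n) :
    125 * a + 360 * n < 1000 ∧
      (125 * a + 360 * n ≤ 495 ∨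
        (if load (run P [] (I ++ J)) b + 101 / 200 ≤ 1 then 0 else 1) = 1) ∧
      (125 * a + 360 * n ≤ 361 ∧ a ≠ 0 ∨
        (if load (run P [] (I ++ J)) b + (16 / 25 - β) ≤ 1 then 0 else 1) = 1) := by
  have hα := h.pos
  have hβ := h'.pos
  have hβ' := h'.le
  have hle := (hP _ ((packableIn_medium h h').mono_bins zero_le_one (by omega))).1 b
  have hload : load (run P [] (I ++ J)) b = load (run P [] I) b + load (run P I J) b := by
    rw [run_append, load_append]; rfl
  have h1 : (a : ℚ) * (1 / 8) ≤ load (run P [] I) b := ha ▸ cnt_mul_le_load h.le_fst b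
  have h2 : (n : ℚ) * (9 / 25) ≤ load (run P I J) b := hn ▸ cnt_mul_le_load h'.le_fst b
  -- A bin without tiny items was opened by a medium item, hence contains a large one, and is closed
  -- to 16/25 − β.
  have h3 : a = 0 → (n : ℚ) * (9 / 25) + 4 * β ≤ load (run P I J) b := by
    intro h0
    obtain ⟨x, hx, hxu⟩ := h'.exists_large b hb (cnt_eq_zero_iff.1 (ha.trans h0))
    have := cnt_mul_add_le_load h'.le_fst hx
    rw [hn] at this
    linarith
  have h4 : a ≠ 0 → (a : ℚ) * (1 / 8) + 4 * α ≤ load (run P [] I) b := by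
    intro h0
    rw [← ha]
    exact h.load_ge (by by_contra hc; exact h0 (ha ▸ cnt_eq_zero_iff.2 hc))
  have h5 : (a : ℚ) * (1 / 8) + n * (9 / 25) < load (run P [] (I ++ J)) b := by
    rcases eq_or_ne a 0 with h0 | h0
    · linarith [h3 h0]
    · linarith [h4 h0]
  refine ⟨?_, or_iff_not_imp_right.2 fun hopen => ?_, or_iff_not_imp_right.2 fun hopen => ?_⟩
  · have : (125 * a + 360 * n : ℚ) < 1000 := by linarith
    exact_mod_cast this
  · simp only [ite_eq_right_iff, zero_ne_one, imp_false, not_not] at hopen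
    have : (125 * a + 360 * n : ℚ) ≤ 495 := by linarith
    exact_mod_cast this
  · simp only [ite_eq_right_iff, zero_ne_one, imp_false, not_not] at hopen
    refine ⟨?_, fun h0 => ?_⟩
    · have : (125 * a + 360 * n : ℚ) ≤ 361 := by linarith
      exact_mod_cast this
    · have hn1 : (1 : ℚ) ≤ n := by
        rw [← hn]
        exact_mod_cast one_le_cnt_of_mem_of_notMem hb (cnt_eq_zero_iff.1 (ha.trans h0))
      linarith [h3 h0]

/-- The cases depend on whether the medium items open at most `20K` new bins. If they open more,
fewer final items 16/25 − β can be offered, but the new bins count in the sums as well. Adding the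
bounds of the continuations, with suitable multiplicities, eliminates the unknown numbers of medium
items per bin, since these sum to `40K`. -/
theorem exists_few_or_many (hP : CostBound P (40 * K) c)
    (h : IsAdaptiveStage P [] I (40 * K) (1 / 8) α) :
    ∑ b ∈ used (run P [] I), weightFew (cnt (run P [] I) b) + 110 * K ≤ 2 * c ∨
      (∑ b ∈ used (run P [] I), weightMany (cnt (run P [] I) b) + 150 * K ≤ 3 * c + 1 ∧
        ∑ b ∈ used (run P [] I), weightMany' (cnt (run P [] I) b) + 160 * K ≤ 3 * c + 2) := by
  obtain ⟨J, β, h'⟩ := exists_isAdaptiveStage P I (40 * K) (u := 9 / 25) (by norm_num)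
  have hB := sum_add_le_medium_half hP h h'
  have hD := card_add_le_medium_full hP h h'
  obtain ⟨L, S, -, hn, hX, -, -⟩ := h'.exists_split
  have hC := fun e => sum_add_le_medium_complement (e := e) hP h h' hX
  have hbin := fun b hb => medium_bin hP h h' (b := b) hb rfl rfl
  have hnew := sum_new P I J
  have hcnt := sum_cnt_append (P := P) I J
  rw [h'.length_eq] at hcnt
  have hfew := sum_used_append (P := P) I J (g := weightFew) rfl
  have hmany := sum_used_append (P := P) I J (g := weightMany) rfl
  have hmany' := sum_used_append (P := P) I J (g := weightMany') rfl
  rw [← hfew, ← hmany, ← hmany']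
  set U := used (run P [] (I ++ J))
  have hcard : U.card = ∑ _b ∈ U, 1 := by simp
  by_cases hZ : L.card ≤ 20 * K
  · left
    have hC' := hC (10 * K) (by omega) le_rfl (by omega)
    have hsum : ∑ b ∈ U, (weightFew (cnt (run P [] I) b) + cnt (run P I J) b) ≤
        ∑ b ∈ U, ((if load (run P [] (I ++ J)) b + 101 / 200 ≤ 1 then 0 else 1) +
          (if load (run P [] (I ++ J)) b + (16 / 25 - β) ≤ 1 then 0 else 1)) := by
      refine Finset.sum_le_sum fun b hb => ?_
      obtain ⟨h1, h2, h3⟩ := hbin b hb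
      exact weightFew_add_le h1 h2 h3
    rw [Finset.sum_add_distrib, Finset.sum_add_distrib] at hsum
    omega
  · right
    -- The least `e` whose bins can take all large medium items, two per bin; rounding up causes the
    -- additive constants in the conclusion.
    have hC' := hC ((L.card + 1) / 2) (by omega) (by omega) (by omega)
    have hsum : ∑ b ∈ U, (weightMany (cnt (run P [] I) b) + cnt (run P I J) b +
          (if cnt (run P [] I) b = 0 then 1 else 0)) ≤
        ∑ b ∈ U, (1 + (if load (run P [] (I ++ J)) b + 101 / 200 ≤ 1 then 0 else 1) +
          (if load (run P [] (I ++ J)) b + (16 / 25 - β) ≤ 1 then 0 else 1)) := by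
      refine Finset.sum_le_sum fun b hb => ?_
      obtain ⟨h1, h2, h3⟩ := hbin b hb
      exact weightMany_add_le h1 h2 h3
    have hsum' : ∑ b ∈ U, (weightMany' (cnt (run P [] I) b) + cnt (run P I J) b +
          (if cnt (run P [] I) b = 0 then 1 else 0)) ≤
        ∑ b ∈ U, ((if load (run P [] (I ++ J)) b + 101 / 200 ≤ 1 then 0 else 1) +
          2 * (if load (run P [] (I ++ J)) b + (16 / 25 - β) ≤ 1 then 0 else 1)) := by
      refine Finset.sum_le_sum fun b hb => ?_
      obtain ⟨h1, h2, h3⟩ := hbin b hb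
      exact weightMany'_add_le h1 h2 h3
    simp only [Finset.sum_add_distrib, ← Finset.mul_sum] at hsum hsum'
    omega

end MediumItems

/-! ### The tight items of size 3/8 − 3α/2. -/

theorem weightTight_add_le {a n q : ℕ} (h : a + 3 * n < 8) (hq : a + 3 * n < 4 ∨ q = 1) :
    weightTight a + n ≤ 1 + q := by
  rw [weightTight]
  split_ifs <;> omega

section TightItems

variable {P : List Item → Item → ℕ} {K c : ℕ} {I : Input} {α : ℚ} {v : Item}

theorem sizes_append_replicate (I : Input) (n : ℕ) (v : Item) :
    sizes (I ++ List.replicate n v) = sizes I + Multiset.replicate n (v : ℚ) := by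
  rw [sizes_append, sizes, sizes, List.map_replicate, Multiset.coe_replicate]

/-- The tight items are packed in pairs into `19K` bins, each pair with one large or two small tiny
items; two small ones give at most 1 − α. The other small items go with the final items. The bound
on the number of large items is what makes them fit among the `19K` pairs. -/
theorem packableIn_tight (h : IsAdaptiveStage P [] I (40 * K) (1 / 8) α)
    (hv : (v : ℚ) = 3 / 8 - 3 / 2 * α) (hX : (used (run P [] I)).card ≤ 19 * K) :
    PackableIn (sizes (I ++ List.replicate (38 * K) v) +
      Multiset.replicate (21 * K) (7 / 8 - α)) (40 * K) 1 := by
  obtain ⟨L, S, hI, hn, hLX, hL, hS⟩ := h.exists_split_nil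
  have hα := h.pos
  have hα' := h.le
  obtain ⟨S₁, S₂, rfl, hS₁⟩ := exists_add_of_le_card S (k := 38 * K - 2 * L.card) (by omega)
  rw [Multiset.card_add] at hn
  have h1 : PackableIn (L + Multiset.replicate (2 * L.card) (v : ℚ)) L.card 1 := by
    refine ((PackableIn.of_card_one (u := 63 / 500) (by norm_num)
      (fun x hx => (hL x hx).trans (by norm_num)) le_rfl).superpose
      (PackableIn.of_card (u := (v : ℚ)) (by linarith) 2 _
        (fun x hx => (Multiset.eq_of_mem_replicate hx).le) (by simp))).mono ?_
    rw [hv]; push_cast; linarith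
  have h2 : PackableIn (S₁ + Multiset.replicate (38 * K - 2 * L.card) (v : ℚ))
      (19 * K - L.card) 1 := by
    refine ((PackableIn.of_card (u := 1 / 8 + α) (by linarith) 2 _
      (fun x hx => hS x (Multiset.mem_add.2 (Or.inl hx))) (by omega)).superpose
      (PackableIn.of_card (u := (v : ℚ)) (by linarith) 2 _
        (fun x hx => (Multiset.eq_of_mem_replicate hx).le)
        (by rw [Multiset.card_replicate]; omega))).mono ?_
    rw [hv]; push_cast; linarith
  have h3 : PackableIn (S₂ + Multiset.replicate (21 * K) (7 / 8 - α)) (21 * K) 1 :=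
    (packableIn_add_replicate (c := 1) (u := 1 / 8 + α) (by linarith) (by linarith)
      (fun x hx => hS x (Multiset.mem_add.2 (Or.inr hx))) (by omega)).mono
      (by push_cast; linarith)
  have h4 := (h1.juxtapose h2).juxtapose h3
  have h5 : sizes (I ++ List.replicate (38 * K) v) + Multiset.replicate (21 * K) (7 / 8 - α) =
      L + Multiset.replicate (2 * L.card) (v : ℚ) +
        (S₁ + Multiset.replicate (38 * K - 2 * L.card) (v : ℚ)) +
        (S₂ + Multiset.replicate (21 * K) (7 / 8 - α)) := by
    rw [sizes_append_replicate, hI,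
      show Multiset.replicate (38 * K) (v : ℚ) = Multiset.replicate (2 * L.card) (v : ℚ) +
        Multiset.replicate (38 * K - 2 * L.card) (v : ℚ) by
          rw [← Multiset.replicate_add]; congr 1; omega]
    abel
  rw [h5]
  convert h4 using 1
  omega

/-- A small tiny item, a tight item and a final item 1/2 + α/2 fill a bin exactly in the worst case.
Large tiny items go three to a bin with a final item (`t` bins), or singly with two tight items (`t
− 2K` bins). The conditions on `t` say that there is room for all large and all small items. -/
theorem packableIn_tight_half (h : IsAdaptiveStage P [] I (40 * K) (1 / 8) α)
    (hv : (v : ℚ) = 3 / 8 - 3 / 2 * α) {t : ℕ} (ht : 2 * K ≤ t)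
    (hXt : (used (run P [] I)).card + 2 * K ≤ 4 * t)
    (htX : 2 * t ≤ 2 * K + (used (run P [] I)).card) (htK : t ≤ 21 * K) :
    PackableIn (sizes (I ++ List.replicate (38 * K) v) +
      Multiset.replicate (42 * K - t) (1 / 2 + α / 2)) (40 * K) 1 := by
  obtain ⟨L, S, hI, hn, hLX, hL, hS⟩ := h.exists_split_nil
  have hα := h.pos
  have hα' := h.le
  obtain ⟨L₁, L₂, rfl, hL₁⟩ := exists_add_of_le_card L (min_le_right (3 * t) L.card)
  rw [Multiset.card_add] at hn hLX hL₁
  have hL63 : ∀ x ∈ L₁ + L₂, x ≤ 63 / 500 := fun x hx => (hL x hx).trans (by norm_num)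
  have h1 : PackableIn (L₁ + Multiset.replicate t (1 / 2 + α / 2)) t 1 :=
    (packableIn_add_replicate (c := 3) (u := 63 / 500) (by linarith) (by linarith)
      (fun x hx => hL63 x (Multiset.mem_add.2 (Or.inl hx))) (by omega)).mono
      (by push_cast; linarith)
  have h2 : PackableIn (L₂ + Multiset.replicate (2 * (t - 2 * K)) (v : ℚ)) (t - 2 * K) 1 := by
    refine ((PackableIn.of_card_one (u := 63 / 500) (by norm_num)
      (fun x hx => hL63 x (Multiset.mem_add.2 (Or.inr hx))) (by omega)).superpose
      (PackableIn.of_card (u := (v : ℚ)) (by linarith) 2 _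
        (fun x hx => (Multiset.eq_of_mem_replicate hx).le) (by simp))).mono ?_
    rw [hv]; push_cast; linarith
  have h3 : PackableIn (S + Multiset.replicate (42 * K - 2 * t) (v : ℚ) +
      Multiset.replicate (42 * K - 2 * t) (1 / 2 + α / 2)) (42 * K - 2 * t) 1 := by
    refine (((PackableIn.of_card_one (u := 1 / 8 + α) (by linarith) hS (by omega)).superpose
      (packableIn_replicate (w := (v : ℚ)) (by linarith) le_rfl)).superpose
      (packableIn_replicate (by linarith) le_rfl)).mono ?_
    rw [hv]; linarith
  have h4 := (h1.juxtapose h2).juxtapose h3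
  have h5 : sizes (I ++ List.replicate (38 * K) v) +
      Multiset.replicate (42 * K - t) (1 / 2 + α / 2) =
      L₁ + Multiset.replicate t (1 / 2 + α / 2) +
        (L₂ + Multiset.replicate (2 * (t - 2 * K)) (v : ℚ)) +
        (S + Multiset.replicate (42 * K - 2 * t) (v : ℚ) +
          Multiset.replicate (42 * K - 2 * t) (1 / 2 + α / 2)) := by
    rw [sizes_append_replicate, hI,
      show 38 * K = 2 * (t - 2 * K) + (42 * K - 2 * t) by omega,
      show 42 * K - t = t + (42 * K - 2 * t) by omega, Multiset.replicate_add,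
      Multiset.replicate_add]
    abel
  rw [h5]
  convert h4 using 1
  omega

theorem sum_weightTight_add_le (hP : CostBound P (40 * K) c)
    (h : IsAdaptiveStage P [] I (40 * K) (1 / 8) α)
    (hX : 2 * K ≤ (used (run P [] I)).card) (hX' : (used (run P [] I)).card ≤ 19 * K) :
    ∑ b ∈ used (run P [] I), weightTight (cnt (run P [] I) b) + 101 * K ≤
      2 * c + max (2 * K) (((used (run P [] I)).card + 2 * K + 3) / 4) := by
  have hα := h.pos
  have hα' := h.le
  set X := (used (run P [] I)).card with hXdef
  -- The smallest `t` admitted by `packableIn_tight_half`, hence the largest number `42K − t` of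
  -- final items.
  set t := max (2 * K) ((X + 2 * K + 3) / 4) with ht
  let v : Item := ⟨3 / 8 - 3 / 2 * α, by linarith, by linarith⟩
  have hv : (v : ℚ) = 3 / 8 - 3 / 2 * α := rfl
  let w : Item := ⟨7 / 8 - α, by linarith, by linarith⟩
  let w' : Item := ⟨1 / 2 + α / 2, by linarith, by linarith⟩
  set J : Input := List.replicate (38 * K) v with hJ
  have hpD := packableIn_tight h hv hX'
  have hpE := packableIn_tight_half (t := t) h hv (by omega) (by omega) (by omega) (by omega)
  rw [← hJ] at hpD hpE
  have hloads : ∀ b, load (run P [] (I ++ J)) b = load (run P [] I) b + load (run P I J) b :=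
    fun b => by rw [run_append, load_append]; rfl
  have hJv : ∀ p ∈ run P I J, (v : ℚ) ≤ (p.1 : ℚ) := fun p hp =>
    (congrArg Subtype.val (List.eq_of_mem_replicate (fst_mem_of_mem_run hp))).ge
  have hbin : ∀ b, cnt (run P [] I) b * (1 / 8) + (if cnt (run P [] I) b = 0 then 0 else 4 * α) +
      cnt (run P I J) b * (v : ℚ) ≤ load (run P [] (I ++ J)) b := by
    intro b
    rw [hloads]
    refine add_le_add ?_ (cnt_mul_le_load hJv b)
    split_ifs with h0
    · simpa [h0] using load_nonneg _ b
    · exact h.load_ge (by by_contra hc; exact h0 (cnt_eq_zero_iff.2 hc))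
  have hone : ∀ b, load (run P [] (I ++ J)) b ≤ 1 := by
    intro b
    have hl := (hP (I ++ J ++ List.replicate (21 * K) w)
      (by rw [sizes_append_replicate]; exact hpD)).1 b
    rw [run_append, load_append] at hl
    linarith [load_nonneg (run P ([] ++ (I ++ J)) (List.replicate (21 * K) w)) b]
  have hD := hP.card_add_le_of_closed (w := w) (by change 1 / 2 < 7 / 8 - α; linarith) hpD
    fun b hb => by
      change 1 < _ + (7 / 8 - α)
      have h1 := hbin b
      split_ifs at h1 with h0
      · have h2 : (1 : ℚ) ≤ cnt (run P I J) b := by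
          exact_mod_cast one_le_cnt_of_mem_of_notMem hb (cnt_eq_zero_iff.1 h0)
        rw [h0] at h1
        nlinarith
      · have h2 : (1 : ℚ) ≤ cnt (run P [] I) b := by
          exact_mod_cast Nat.one_le_iff_ne_zero.2 h0
        have h3 : 0 ≤ cnt (run P I J) b * (v : ℚ) := by
          have : (0 : ℚ) ≤ v := by linarith
          positivity
        linarith
  have hE := hP.sum_add_le (w := w') (by change 1 / 2 < 1 / 2 + α / 2; linarith) hpE
  have hsum : ∑ b ∈ used (run P [] (I ++ J)),
      (weightTight (cnt (run P [] I) b) + cnt (run P I J) b) ≤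
      ∑ b ∈ used (run P [] (I ++ J)),
        (1 + (if load (run P [] (I ++ J)) b + w' ≤ 1 then 0 else 1)) := by
    refine Finset.sum_le_sum fun b _ => ?_
    have h1 := hbin b
    have h2 := hone b
    have h3 : cnt (run P I J) b ≤ 2 := by
      by_contra hc
      have h4 : (3 : ℚ) ≤ cnt (run P I J) b := by exact_mod_cast (by omega)
      have h5 : (0 : ℚ) ≤ cnt (run P [] I) b := by positivity
      split_ifs at h1 <;> nlinarith
    have h3' : (cnt (run P I J) b : ℚ) ≤ 2 := by exact_mod_cast h3
    -- The factor 4 of the adaptive stage matters here: at most two tight items fall short of 3/8 by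
    -- 3α altogether, so the excess 4α of the large tiny item still leaves α.
    have h6 : cnt (run P [] I) b ≠ 0 →
        ((cnt (run P [] I) b : ℚ) + 3 * cnt (run P I J) b) / 8 + α ≤
          load (run P [] (I ++ J)) b := by
      intro h0
      rw [if_neg h0, hv] at h1
      nlinarith
    have h7 : cnt (run P [] I) b = 0 →
        (cnt (run P I J) b : ℚ) * (373 / 1000) ≤ load (run P [] (I ++ J)) b := by
      intro h0
      rw [if_pos h0, hv, h0] at h1
      push_cast at h1
      nlinarith
    refine weightTight_add_le ?_ (or_iff_not_imp_right.2 fun hopen => ?_)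
    · rcases eq_or_ne (cnt (run P [] I) b) 0 with h0 | h0
      · omega
      · have : ((cnt (run P [] I) b : ℚ) + 3 * cnt (run P I J) b) < 8 := by linarith [h6 h0]
        exact_mod_cast this
    · simp only [ite_eq_right_iff, zero_ne_one, imp_false, not_not] at hopen
      change _ + (1 / 2 + α / 2) ≤ (1 : ℚ) at hopen
      rcases eq_or_ne (cnt (run P [] I) b) 0 with h0 | h0
      · have : (cnt (run P I J) b : ℚ) < 2 := by linarith [h7 h0]
        have : cnt (run P I J) b < 2 := by exact_mod_cast this
        omega
      · have : ((cnt (run P [] I) b : ℚ) + 3 * cnt (run P I J) b) < 4 := by linarith [h6 h0]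
        exact_mod_cast this
  have hcnt := sum_cnt_append (P := P) I J
  have hJl : J.length = 38 * K := by rw [hJ, List.length_replicate]
  have htight := sum_used_append (P := P) I J (g := weightTight) rfl
  have hcard : (used (run P [] (I ++ J))).card = ∑ _b ∈ used (run P [] (I ++ J)), 1 := by simp
  rw [Finset.sum_add_distrib, Finset.sum_add_distrib] at hsum
  omega

end TightItems

/-! ### Combination of the inequalities. -/

/-- No rule can guarantee fewer than `87 / 62` times the optimal cost. -/
theorem le_of_costBound {P : List Item → Item → ℕ} {K c : ℕ} (hK : 1000 ≤ K)
    (hP : CostBound P (40 * K) c) : 87 * (40 * K) ≤ 62 * c := by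
  obtain ⟨I, α, h⟩ := exists_isAdaptiveStage P [] (40 * K) (u := 1 / 8) (by norm_num)
  have hpack : PackableIn (sizes I) (40 * K) 1 :=
    (PackableIn.of_card_one (u := 63 / 500) (by norm_num)
      (fun x hx => (h.le_of_mem_sizes x hx).trans (by norm_num))
      (by rw [card_sizes, h.length_eq])).mono (by norm_num)
  have hA := card_add_le_of_first_stage hP h
  have h0 := exists_few_or_many hP h
  have hcnt : ∑ b ∈ used (run P [] I), cnt (run P [] I) b = 40 * K := by
    rw [sum_cnt subset_rfl, length_run, h.length_eq]
  have hseven : ∀ b ∈ used (run P [] I), 1 ≤ cnt (run P [] I) b ∧ cnt (run P [] I) b ≤ 7 :=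
    fun b hb => ⟨cnt_pos hb, cnt_le_seven hP hpack h hb⟩
  have hcard : (used (run P [] I)).card = ∑ _b ∈ used (run P [] I), 1 := by simp
  have hX : 40 * K ≤ 7 * (used (run P [] I)).card := by
    rw [hcard, Finset.mul_sum, ← hcnt]
    exact Finset.sum_le_sum fun b hb => (hseven b hb).2
  by_contra hc
  -- If `c` is below the claimed bound, `hA` gives at most `19K` used bins; at least `2K` are needed
  -- because no bin holds more than seven tiny items.
  have h1 := sum_weightTight_add_le hP h (by omega) (by omega)
  -- Up to the scaling by 24, the coefficients satisfy a ≤ 1 + 2 · few + tight for all `1 ≤ a ≤ 7`,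
  -- with equality for a = 1, 2, 5, 7.
  have hfew : ∑ b ∈ used (run P [] I), 24 * cnt (run P [] I) b ≤
      ∑ b ∈ used (run P [] I), (24 * 1 + 48 * weightFew (cnt (run P [] I) b) +
        24 * weightTight (cnt (run P [] I) b)) := by
    refine Finset.sum_le_sum fun b hb => ?_
    have := hseven b hb
    rw [weightFew, weightTight]
    split_ifs <;> omega
  have hmany : ∑ b ∈ used (run P [] I), (4 * cnt (run P [] I) b + 1) ≤
      ∑ b ∈ used (run P [] I), (4 * weightTight (cnt (run P [] I) b) +
        5 * weightMany (cnt (run P [] I) b) + 2 * weightMany' (cnt (run P [] I) b)) := by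
    refine Finset.sum_le_sum fun b hb => ?_
    have := hseven b hb
    rw [weightMany, weightMany', weightTight]
    split_ifs <;> omega
  simp only [Finset.sum_add_distrib, ← Finset.mul_sum, ← hcard, hcnt] at hfew hmany
  -- Up to rounding, the first case forces `c` to be at least about `56.15K` and the second about
  -- `56.26K`, whereas 87 · 40/62 is below 56.13. This slack absorbs the rounding because `K ≥
  -- 1000`.
  omega

end BinPacking

open BinPacking in
theorem theorem2 (A : BinPacking.KnownOptAlgorithm) :
    (87 / 62 : ENNReal) ≤ A.competitiveRatio := by
  refine Filter.le_limsup_of_frequently_le' (Filter.frequently_atTop.2 fun N => ?_)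
  -- For the limsup, arbitrarily large multiples of 40 suffice.
  refine ⟨40 * (N + 1000), by omega, ?_⟩
  set Q : ℕ := 40 * (N + 1000) with hQ
  by_contra hlt
  rw [not_le] at hlt
  have hQ0 : (Q : ENNReal) ≠ 0 := by rw [hQ]; positivity
  have hcost : ∀ I, opt I = Q → 62 * A.cost I < 87 * Q := by
    intro I hI
    have h1 : (A.cost I : ENNReal) ≤ A.worstCost Q :=
      le_iSup₂ (f := fun (I : Input) (_ : I ∈ {I : Input | opt I = Q}) => (A.cost I : ENNReal)) I hI
    have h2 : (A.cost I : ENNReal) / Q < 87 / 62 := (ENNReal.div_le_div_right h1 _).trans_lt hlt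
    rw [ENNReal.div_lt_iff (Or.inl hQ0) (Or.inl (by simp)), mul_comm, ← mul_div_assoc,
      ENNReal.lt_div_iff_mul_lt (Or.inl (by norm_num)) (Or.inl (by norm_num))] at h2
    have h3 : A.cost I * 62 < Q * 87 := by exact_mod_cast h2
    omega
  -- This `c` is the largest integer with `62 * c < 87 * Q`.
  have hP := costBound_place A (Q := Q) (c := (87 * Q - 1) / 62) fun I hI => by
    have := hcost I hI
    omega
  have := le_of_costBound (K := N + 1000) (by omega) hP
  omega
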